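/- Let $k\ge 2$ be an integer and $H_{n,2}=\sum_{m=1}^n m^{-2}$. For $|\phi|<1$ let $$\Pi_{k,2}(\phi)=\sum_{n=1}^\infty \frac{(-1)^nH_{n,2}}{(n+1)^k}\,\phi^{n+1}.$$ For $\varphi\in\mathbb{C}\setminus(-\infty,0]$ with $|\varphi|<1$, and with $\log$ the principal branch of the logarithm, let $$\begin{aligned} \varpi^{k,2}_i&=\log^i\varphi,\qquad i=0,1,\dots,k-1,\\ \varpi^{k,2}_k&=\log^k\varphi+k!\sum_{n=1}^\infty\frac{(-1)^n}{n^k}\varphi^n,\\ \varpi^{k,2}_{k+1}&=\log^{k+1}\varphi+(k+1)\,k!\Big(\sum_{n=1}^\infty\frac{(-1)^n}{n^k}\varphi^n\Big)\log\varphi-k\,(k+1)!\sum_{n=1}^\infty\frac{(-1)^n}{n^{k+1}}\varphi^n,\\ \varpi^{k,2}_{k+2}&=\log^{k+2}\varphi+\binom{k+2}{2}k!\Big(\sum_{n=1}^\infty\frac{(-1)^n}{n^k}\varphi^n\Big)\log^2\varphi-(k+2)\,k\,(k+1)!\Big(\sum_{n=1}^\infty\frac{(-1)^n}{n^{k+1}}\varphi^n\Big)\log\varphi\\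 &\quad+\sum_{n=1}^\infty (k+2)!\,(-1)^n\,\frac{\binom{k+1}{2}+n^2H_{n,2}}{n^{k+2}}\,\varphi^n . \end{aligned}$$ Then $\Pi_{k,2}$ continues analytically to the slit plane $\mathbb{C}\setminus(-\infty,0]$ (in the sense that a holomorphic function on the slit plane agrees with $\Pi_{k,2}$ at its points with $|\phi|<1$), and there are unique complex numbers $\tau^{k,2}_0,\dots,\tau^{k,2}_{k+2}$ such that this continuation satisfies $$\Pi_{k,2}(1/\varphi)=\sum_{i=0}^{k+2}\tau^{k,2}_i\,\varpi^{k,2}_i(\varphi)\qquad\text{for all }\varphi\in\mathbb{C}\setminus(-\infty,0],\ |\varphi|<1 .$$ Moreover, every $\tau^{k,2}_i$ lies in the field $\mathbb{Q}(\pi,\zeta(3),\zeta(4),\dots,\zeta(k+2))\subset\mathbb{C}$, where $\zeta$ is the Riemann zeta function. -/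

import Mathlib

/-- The generalized harmonic number `H_{n,t} = ∑_{m=1}^n 1 / m^t`, as a complex number. -/
noncomputable def harmonicNumber (n t : ℕ) : ℂ :=
  ∑ m ∈ Finset.Icc 1 n, 1 / (m : ℂ) ^ t

/-- The power series `Π_{k,2}(ϕ) = ∑_{n ≥ 1} (-1)^n H_{n,2} / (n+1)^k ϕ^(n+1)`.
The term `n = 0` vanishes because `H_{0,2} = 0`. -/
noncomputable def PiSeries (k : ℕ) (x : ℂ) : ℂ :=
  ∑' n : ℕ, (-1 : ℂ) ^ n * harmonicNumber n 2 / ((n : ℂ) + 1) ^ k * x ^ (n + 1)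

/-- The power series `∑_{n ≥ 1} (-1)^n / n^s φ^n` (the summation index is shifted by one). -/
noncomputable def altPolylog (s : ℕ) (x : ℂ) : ℂ :=
  ∑' n : ℕ, (-1 : ℂ) ^ (n + 1) / ((n : ℂ) + 1) ^ s * x ^ (n + 1)

/-- The power series `∑_{n ≥ 1} (k+2)! (-1)^n (binom (k+1) 2 + n^2 H_{n,2}) / n^(k+2) φ^n`
(the summation index is shifted by one). -/
noncomputable def lastSeries (k : ℕ) (x : ℂ) : ℂ :=
  ∑' n : ℕ, (Nat.factorial (k + 2) : ℂ) * (-1 : ℂ) ^ (n + 1) *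
    (((Nat.choose (k + 1) 2 : ℕ) : ℂ) + ((n : ℂ) + 1) ^ 2 * harmonicNumber (n + 1) 2) /
      ((n : ℂ) + 1) ^ (k + 2) * x ^ (n + 1)

/-- The canonical basis `ϖ^{k,2}_0, …, ϖ^{k,2}_{k+2}` on the disc `|φ| < 1`, slit along
`(-1, 0]`, with the principal branch of the logarithm. (Only the indices `i ≤ k + 2` are used.) -/
noncomputable def varpi (k i : ℕ) (x : ℂ) : ℂ :=
  if i < k then Complex.log x ^ i
  else if i = k then
    Complex.log x ^ k + (Nat.factorial k : ℂ) * altPolylog k x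
  else if i = k + 1 then
    Complex.log x ^ (k + 1)
      + ((k : ℂ) + 1) * ((Nat.factorial k : ℂ) * altPolylog k x) * Complex.log x
      + (-(k : ℂ) * (Nat.factorial (k + 1) : ℂ)) * altPolylog (k + 1) x
  else
    Complex.log x ^ (k + 2)
      + ((Nat.choose (k + 2) 2 : ℕ) : ℂ) * ((Nat.factorial k : ℂ) * altPolylog k x)
          * Complex.log x ^ 2
      + ((k : ℂ) + 2) * ((-(k : ℂ) * (Nat.factorial (k + 1) : ℂ)) * altPolylog (k + 1) x)
          * Complex.log x
      + lastSeries k x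

/-- `F` is the analytic continuation of `Π_{k,2}` from the unit disc to the slit plane
`ℂ ∖ (-∞, 0]`, which is simply connected and avoids the singular points `0` and `-1`. -/
def IsPiContinuation (k : ℕ) (F : ℂ → ℂ) : Prop :=
  DifferentiableOn ℂ F Complex.slitPlane ∧
    ∀ x ∈ Complex.slitPlane, ‖x‖ < 1 → F x = PiSeries k x

/-- `τ` is a family of coefficients in the expansion `Π_{k,2} = ∑ i, τ_i ϖ^{k,2}_i`:
the continuation of `Π_{k,2}` equals, at every point `ϕ = 1 / φ` of the slit plane
with `|φ| < 1`, the sum `∑ i, τ_i ϖ^{k,2}_i(φ)`. -/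
def IsExpansionCoeff (k : ℕ) (τ : Fin (k + 3) → ℂ) : Prop :=
  ∃ F : ℂ → ℂ, IsPiContinuation k F ∧
    ∀ y ∈ Complex.slitPlane, ‖y‖ < 1 → F (1 / y) = ∑ i : Fin (k + 3), τ i * varpi k i y

/-- The field `ℚ(π, ζ(3), …, ζ(k+2))`, as a subfield of `ℂ`. -/
noncomputable def zetaField (k : ℕ) : IntermediateField ℚ ℂ :=
  IntermediateField.adjoin ℚ
    ({(Real.pi : ℂ)} ∪ {z : ℂ | ∃ m : ℕ, 3 ≤ m ∧ m ≤ k + 2 ∧ z = riemannZeta (m : ℂ)})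

open Filter Topology Complex

/-! In the coordinate `x = exp w` the slit plane becomes the strip `|Im w| < π`, inversion becomes
`w ↦ -w`, and `d/dw` lowers the exponent `k` of every series by one. At `k = 0` the series is `exp w
/ (1 + exp w)` times a dilogarithm, so the dilogarithm inversion formula gives its expansion at
infinity (`hasExpansion_zero`). Integrating in `w` climbs to every `k`, at the price of one new
constant per step (`exists_expansion_constants`).

The points `w = ±iπ` both lie over `x = -1`, where the series converges absolutely once `k ≥ 2`.
Equating the two boundary values of the expansion gives `expansion_constant_recursion`: only even
powers of `πi` and one zeta value enter, so the constants stay in the field.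

Uniqueness holds because, as `w → -∞` along the reals, each basis function differs from `w ^ i` by
an exponentially small term, while no nonzero polynomial tends to zero (`varpi_linearIndependent`).
-/

/-- The series `∑ b n / (n+1)^k x^(n+1)` in the logarithmic coordinate `x = exp w`. -/
noncomputable def expSeries (b : ℕ → ℂ) (k : ℕ) (w : ℂ) : ℂ :=
  ∑' n : ℕ, b n / ((n : ℂ) + 1) ^ k * exp w ^ (n + 1)

/-- The horizontal strip `|Im w| < π`, the image of the slit plane under the logarithm. -/
def logStrip : Set ℂ := {w | -Real.pi < w.im ∧ w.im < Real.pi}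

/-- The left half of the strip, the image of the slit unit disc under the logarithm. -/
def halfStrip : Set ℂ := {w | (-Real.pi < w.im ∧ w.im < Real.pi) ∧ w.re < 0}

/-! ### Geometry of the strip -/

lemma convex_logStrip : Convex ℝ logStrip := by
  have : logStrip = Complex.imCLM ⁻¹' Set.Ioo (-Real.pi) Real.pi := by
    ext w; simp [logStrip]
  rw [this]
  exact (convex_Ioo _ _).linear_preimage (Complex.imLm)

lemma convex_halfStrip : Convex ℝ halfStrip := by
  have : halfStrip = logStrip ∩ Complex.reLm ⁻¹' Set.Iio 0 := by
    ext w; simp [halfStrip, logStrip]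
  rw [this]
  exact convex_logStrip.inter ((convex_Iio _).linear_preimage Complex.reLm)

lemma isOpen_logStrip : IsOpen logStrip :=
  (isOpen_lt continuous_const continuous_im).inter (isOpen_lt continuous_im continuous_const)

lemma isOpen_halfStrip : IsOpen halfStrip :=
  isOpen_logStrip.inter (isOpen_lt continuous_re continuous_const)

lemma neg_mem_logStrip {w : ℂ} (hw : w ∈ logStrip) : -w ∈ logStrip := by
  obtain ⟨h1, h2⟩ := hw
  constructor <;> simp <;> linarith

lemma neg_one_mem_halfStrip : (-1 : ℂ) ∈ halfStrip := by
  simp [halfStrip, Real.pi_pos]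

lemma norm_exp_lt_one {w : ℂ} (hw : w.re < 0) : ‖exp w‖ < 1 := by
  rw [norm_exp]; exact Real.exp_lt_one_iff.2 hw

lemma one_add_exp_ne_zero {w : ℂ} (hw : w ∈ logStrip) : 1 + exp w ≠ 0 := by
  intro h
  have h1 : exp w = -1 := by linear_combination h
  have h2 := log_exp hw.1 hw.2.le
  rw [h1, log_neg_one] at h2
  have h3 := hw.2
  rw [← h2] at h3
  simp at h3

/-! ### Series in the logarithmic coordinate: derivatives, primitives, boundary values -/

lemma norm_nat_add_one (n : ℕ) : ‖(n : ℂ) + 1‖ = (n : ℝ) + 1 := by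
  rw [← Nat.cast_add_one, norm_natCast]; push_cast; ring

lemma norm_expSeries_term_le {b : ℕ → ℂ} {C : ℝ} (hb : ∀ n, ‖b n‖ ≤ C) (k : ℕ) (w : ℂ) (n : ℕ) :
    ‖b n / ((n : ℂ) + 1) ^ k * exp w ^ (n + 1)‖ ≤ C * ‖exp w‖ ^ (n + 1) := by
  rw [norm_mul, norm_pow, norm_div, norm_pow, norm_nat_add_one]
  gcongr
  refine (div_le_self (norm_nonneg _) (one_le_pow₀ ?_)).trans (hb n)
  linarith [(Nat.cast_nonneg n : (0 : ℝ) ≤ n)]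

lemma summable_expSeries {b : ℕ → ℂ} {C : ℝ} (hb : ∀ n, ‖b n‖ ≤ C) (k : ℕ) {w : ℂ}
    (hw : w.re < 0) : Summable fun n : ℕ => b n / ((n : ℂ) + 1) ^ k * exp w ^ (n + 1) := by
  refine Summable.of_norm_bounded (g := fun n => C * ‖exp w‖ ^ (n + 1)) ?_
    (norm_expSeries_term_le hb k w)
  exact ((summable_nat_add_iff 1).2
    (summable_geometric_of_lt_one (norm_nonneg _) (norm_exp_lt_one hw))).mul_left C

lemma hasDerivAt_expSeries {b : ℕ → ℂ} {C : ℝ} (hb : ∀ n, ‖b n‖ ≤ C) (k : ℕ) {w : ℂ}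
    (hw : w.re < 0) : HasDerivAt (expSeries b (k + 1)) (expSeries b k w) w := by
  have hC : 0 ≤ C := (norm_nonneg _).trans (hb 0)
  -- On this half-plane `‖exp z‖` stays below a fixed number less than one, which gives a uniform
  -- geometric majorant.
  set t : Set ℂ := {z | z.re < w.re / 2} with ht
  have hto : IsOpen t := isOpen_lt continuous_re continuous_const
  have htc : IsPreconnected t :=
    ((convex_Iio (w.re / 2)).linear_preimage Complex.reLm).isPreconnected
  have hwt : w ∈ t := by change w.re < w.re / 2; linarith
  have hr : Real.exp (w.re / 2) < 1 := Real.exp_lt_one_iff.2 (by linarith)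
  refine hasDerivAt_tsum_of_isPreconnected (u := fun n => C * Real.exp (w.re / 2) ^ (n + 1))
    (((summable_nat_add_iff 1).2
      (summable_geometric_of_lt_one (Real.exp_pos _).le hr)).mul_left C) hto htc
    (y₀ := w) (g := fun n z => b n / ((n : ℂ) + 1) ^ (k + 1) * exp z ^ (n + 1))
    (g' := fun n z => b n / ((n : ℂ) + 1) ^ k * exp z ^ (n + 1))
    ?_ ?_ hwt (summable_expSeries hb _ hw) hwt
  · intro n z _
    have hn : (n : ℂ) + 1 ≠ 0 := Nat.cast_add_one_ne_zero n
    refine (((hasDerivAt_exp z).pow (n + 1)).const_mul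
      (b n / ((n : ℂ) + 1) ^ (k + 1))).congr_deriv ?_
    push_cast
    field_simp
    ring
  · intro n z hz
    refine (norm_expSeries_term_le hb k z n).trans ?_
    rw [norm_exp]
    gcongr
    exact le_of_lt hz

/-- The majorant `C / (n+1)^2` is uniform up to the imaginary axis; this is what makes the values
over `x = -1` usable. -/
lemma continuousOn_expSeries {b : ℕ → ℂ} {C : ℝ} (hb : ∀ n, ‖b n‖ ≤ C) {k : ℕ} (hk : 2 ≤ k) :
    ContinuousOn (expSeries b k) {w | w.re ≤ 0} := by
  have hC : 0 ≤ C := (norm_nonneg _).trans (hb 0)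
  refine continuousOn_tsum (u := fun n : ℕ => C * (1 / ((n : ℝ) + 1) ^ 2)) ?_ ?_ ?_
  · intro n; fun_prop
  · refine Summable.mul_left C ?_
    have := (summable_nat_add_iff 1).2 (Real.summable_one_div_nat_pow.2 one_lt_two)
    simpa using this
  · intro n w hw
    have h1 : (1 : ℝ) ≤ (n : ℝ) + 1 := by linarith [(Nat.cast_nonneg n : (0 : ℝ) ≤ n)]
    rw [norm_mul, norm_pow, norm_div, norm_pow, norm_nat_add_one, norm_exp]
    have h2 : Real.exp w.re ^ (n + 1) ≤ 1 :=
      pow_le_one₀ (Real.exp_pos _).le (Real.exp_le_one_iff.2 hw)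
    have h3 : ‖b n‖ / ((n : ℝ) + 1) ^ k ≤ C / ((n : ℝ) + 1) ^ 2 := by
      gcongr
      · exact hb n
    calc _ ≤ C / ((n : ℝ) + 1) ^ 2 * 1 := by gcongr
      _ = _ := by ring

/-- A holomorphic function on the strip extending `expSeries b k` has a primitive extending
`expSeries b (k + 1)`. -/
lemma exists_primitive_expSeries {b : ℕ → ℂ} {C : ℝ} (hb : ∀ n, ‖b n‖ ≤ C) (k : ℕ) {g : ℂ → ℂ}
    (hg : DifferentiableOn ℂ g logStrip) (hgs : ∀ w ∈ halfStrip, g w = expSeries b k w) :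
    ∃ G : ℂ → ℂ, (∀ w ∈ logStrip, HasDerivAt G (g w) w) ∧
      ∀ w ∈ halfStrip, G w = expSeries b (k + 1) w := by
  obtain ⟨G, hG⟩ := convex_logStrip.exists_forall_hasDerivWithinAt hg
  have hG' : ∀ w ∈ logStrip, HasDerivAt G (g w) w := fun w hw =>
    (hG w hw).hasDerivAt (isOpen_logStrip.mem_nhds hw)
  set c := expSeries b (k + 1) (-1) - G (-1) with hc
  refine ⟨fun w => G w + c, fun w hw => (hG' w hw).add_const c, ?_⟩
  refine isOpen_halfStrip.eqOn_of_deriv_eq convex_halfStrip.isPreconnected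
    (fun w hw => ((hG' w hw.1).add_const c).differentiableAt.differentiableWithinAt)
    (fun w hw => (hasDerivAt_expSeries hb k hw.2).differentiableAt.differentiableWithinAt)
    (fun w hw => ?_) neg_one_mem_halfStrip (by simp [hc])
  rw [((hG' w hw.1).add_const c).deriv, (hasDerivAt_expSeries hb k hw.2).deriv, hgs w hw]

/-- An identity between functions continuous up to the imaginary axis propagates to the axis. -/
lemma eq_on_axis {f g : ℂ → ℂ} (hf : ContinuousOn f {w | w ∈ logStrip ∧ w.re ≤ 0})
    (hg : ContinuousOn g {w | w ∈ logStrip ∧ w.re ≤ 0}) (h : ∀ w ∈ halfStrip, f w = g w)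
    {w : ℂ} (hw : w ∈ logStrip) (hre : w.re ≤ 0) : f w = g w := by
  have hsub : halfStrip ⊆ {w | w ∈ logStrip ∧ w.re ≤ 0} := fun z hz => ⟨hz.1, hz.2.le⟩
  have hcl : w ∈ closure halfStrip := by
    have ht : Tendsto (fun t : ℝ => w + ((-t : ℝ) : ℂ)) (𝓝[>] 0) (𝓝 w) := by
      have : Tendsto (fun t : ℝ => w + ((-t : ℝ) : ℂ)) (𝓝 0) (𝓝 (w + ((-0 : ℝ) : ℂ))) :=
        Continuous.tendsto (by fun_prop) 0
      simp only [neg_zero, ofReal_zero, add_zero] at this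
      exact this.mono_left nhdsWithin_le_nhds
    refine mem_closure_of_tendsto ht ?_
    filter_upwards [self_mem_nhdsWithin] with t ht
    have ht' : (0 : ℝ) < t := ht
    refine ⟨⟨?_, ?_⟩, ?_⟩
    · simpa using hw.1
    · simpa using hw.2
    · simp; linarith
  exact (Set.EqOn.of_subset_closure (s := halfStrip)
    (t := {z | z ∈ halfStrip ∨ z = w}) (fun z hz => h z hz)
    (hf.mono (by rintro z (hz | rfl); exacts [hsub hz, ⟨hw, hre⟩]))
    (hg.mono (by rintro z (hz | rfl); exacts [hsub hz, ⟨hw, hre⟩]))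
    (fun z hz => Or.inl hz)
    (by rintro z (hz | rfl); exacts [subset_closure hz, hcl])) (Or.inr rfl)

/-- An identity on the open segment `(-iπ, iπ)` extends to its end points. -/
lemma eq_on_closed_segment {p q : ℝ → ℂ} (hp : Continuous p) (hq : Continuous q)
    (h : ∀ a : ℝ, -Real.pi < a → a < Real.pi → p a = q a) :
    p Real.pi = q Real.pi ∧ p (-Real.pi) = q (-Real.pi) := by
  have hcl : closure (Set.Ioo (-Real.pi) Real.pi) = Set.Icc (-Real.pi) Real.pi :=
    closure_Ioo (by linarith [Real.pi_pos])
  have := Set.EqOn.closure (s := Set.Ioo (-Real.pi) Real.pi) (fun a ha => h a ha.1 ha.2) hp hq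
  rw [hcl] at this
  exact ⟨this ⟨by linarith [Real.pi_pos], le_rfl⟩, this ⟨le_rfl, by linarith [Real.pi_pos]⟩⟩

lemma continuous_expSeries_axis {b : ℕ → ℂ} {C : ℝ} (hb : ∀ n, ‖b n‖ ≤ C) {k : ℕ} (hk : 2 ≤ k) :
    Continuous fun a : ℝ => expSeries b k (a * I) :=
  (continuousOn_expSeries hb hk).comp_continuous (by fun_prop) (by intro a; simp)

/-! ### Coefficient sequences and their generating functions -/

/-- The coefficients `(-1)^n`, `n ≥ 1`, with the index shifted by one. -/
noncomputable def altCoeff (n : ℕ) : ℂ := (-1) ^ (n + 1)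

/-- The coefficients `(-1)^n H_{n,2}`, `n ≥ 1`, with the index shifted by one. -/
noncomputable def altHarmonicCoeff (n : ℕ) : ℂ := (-1) ^ (n + 1) * harmonicNumber (n + 1) 2

/-- The coefficients of `PiSeries`. -/
noncomputable def piCoeff (n : ℕ) : ℂ := (-1) ^ n * harmonicNumber n 2

lemma norm_altCoeff_le (n : ℕ) : ‖altCoeff n‖ ≤ 1 := by simp [altCoeff]

lemma norm_harmonicNumber_two_le (n : ℕ) :
    ‖harmonicNumber n 2‖ ≤ ∑' m : ℕ, 1 / (m : ℝ) ^ 2 := by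
  refine (norm_sum_le _ _).trans ?_
  simp only [norm_div, norm_one, norm_pow, norm_natCast]
  exact (Real.summable_one_div_nat_pow.2 one_lt_two).sum_le_tsum _ (fun _ _ => by positivity)

lemma norm_altHarmonicCoeff_le (n : ℕ) : ‖altHarmonicCoeff n‖ ≤ ∑' m : ℕ, 1 / (m : ℝ) ^ 2 := by
  simpa [altHarmonicCoeff] using norm_harmonicNumber_two_le (n + 1)

lemma norm_piCoeff_le (n : ℕ) : ‖piCoeff n‖ ≤ ∑' m : ℕ, 1 / (m : ℝ) ^ 2 := by
  simpa [piCoeff] using norm_harmonicNumber_two_le n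

lemma PiSeries_exp (k : ℕ) (w : ℂ) : PiSeries k (exp w) = expSeries piCoeff k w := rfl

lemma altPolylog_exp (s : ℕ) (w : ℂ) : altPolylog s (exp w) = expSeries altCoeff s w := rfl

lemma lastSeries_exp (k : ℕ) {w : ℂ} (hw : w.re < 0) :
    lastSeries k (exp w) = (Nat.factorial (k + 2) : ℂ) *
      (((Nat.choose (k + 1) 2 : ℕ) : ℂ) * expSeries altCoeff (k + 2) w
        + expSeries altHarmonicCoeff k w) := by
  rw [expSeries, expSeries, ← tsum_mul_left,
    ← ((summable_expSeries norm_altCoeff_le (k + 2) hw).mul_left _).tsum_add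
      (summable_expSeries norm_altHarmonicCoeff_le k hw), ← tsum_mul_left, lastSeries]
  refine tsum_congr fun n => ?_
  have hn : (n : ℂ) + 1 ≠ 0 := Nat.cast_add_one_ne_zero n
  rw [altCoeff, altHarmonicCoeff]
  field_simp
  ring

lemma harmonicNumber_succ (n t : ℕ) :
    harmonicNumber (n + 1) t = harmonicNumber n t + 1 / ((n : ℂ) + 1) ^ t := by
  rw [harmonicNumber, Finset.sum_Icc_succ_top (by omega), harmonicNumber]
  push_cast
  rfl

lemma harmonicNumber_zero (t : ℕ) : harmonicNumber 0 t = 0 := by simp [harmonicNumber]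

lemma expSeries_altCoeff_zero {w : ℂ} (hw : w.re < 0) :
    expSeries altCoeff 0 w = -exp w / (1 + exp w) := by
  have h1 : ‖-exp w‖ < 1 := by rw [norm_neg]; exact norm_exp_lt_one hw
  have h : expSeries altCoeff 0 w = ∑' n : ℕ, -exp w * (-exp w) ^ n := by
    refine tsum_congr fun n => ?_
    rw [altCoeff, pow_zero, div_one, ← mul_pow, ← pow_succ']
    congr 1; ring
  rw [h, tsum_mul_left, tsum_geometric_of_norm_lt_one h1, sub_neg_eq_add, div_eq_mul_inv]

/-- Multiplying by `1 + x` takes differences of the alternating coefficients, and `H_{n+1,2} -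
H_{n,2} = 1/(n+1)^2`. -/
lemma one_add_exp_mul_expSeries_altHarmonicCoeff {w : ℂ} (hw : w.re < 0) :
    (1 + exp w) * expSeries altHarmonicCoeff 0 w = expSeries altCoeff 2 w := by
  have hs := summable_expSeries norm_altHarmonicCoeff_le 0 hw
  have hs2 := summable_expSeries norm_altCoeff_le 2 hw
  have h1 : exp w * expSeries altHarmonicCoeff 0 w
      = ∑' n : ℕ, (altCoeff n / ((n : ℂ) + 1) ^ 2 * exp w ^ (n + 1)
        - altHarmonicCoeff n / ((n : ℂ) + 1) ^ 0 * exp w ^ (n + 1)) := by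
    have hd := hs2.sub hs
    rw [hd.tsum_eq_zero_add, expSeries, ← tsum_mul_left]
    have h0 : altCoeff 0 / (((0 : ℕ) : ℂ) + 1) ^ 2 * exp w ^ (0 + 1)
        - altHarmonicCoeff 0 / (((0 : ℕ) : ℂ) + 1) ^ 0 * exp w ^ (0 + 1) = 0 := by
      simp [altCoeff, altHarmonicCoeff, harmonicNumber]
    rw [h0, zero_add]
    refine tsum_congr fun n => ?_
    simp only [altCoeff, altHarmonicCoeff, harmonicNumber_succ (n + 1), pow_zero, div_one]
    push_cast
    ring
  rw [add_mul, one_mul, h1, hs2.tsum_sub hs]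
  simp only [expSeries]
  ring

lemma expSeries_piCoeff_zero {w : ℂ} (hw : w.re < 0) :
    (1 + exp w) * expSeries piCoeff 0 w = exp w * expSeries altCoeff 2 w := by
  rw [← one_add_exp_mul_expSeries_altHarmonicCoeff hw]
  have hs := summable_expSeries norm_piCoeff_le 0 hw
  have h : expSeries piCoeff 0 w = exp w * expSeries altHarmonicCoeff 0 w := by
    rw [expSeries, hs.tsum_eq_zero_add, expSeries, ← tsum_mul_left]
    simp only [piCoeff, harmonicNumber_zero, mul_zero, zero_div, zero_mul, zero_add]
    refine tsum_congr fun n => ?_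
    simp only [altHarmonicCoeff, pow_zero, div_one]
    ring
  rw [h]; ring

lemma expSeries_altCoeff_pi {k : ℕ} (hk : 2 ≤ k) {w : ℂ} (hw : exp w = -1) :
    expSeries altCoeff k w = riemannZeta k := by
  rw [zeta_nat_eq_tsum_of_gt_one (by omega)]
  have hs : Summable fun n : ℕ => 1 / (n : ℂ) ^ k := by
    have := (Complex.summable_one_div_nat_cpow (p := k)).2 (by simpa using (by omega : 1 < k))
    simpa using this
  rw [hs.tsum_eq_zero_add]
  simp only [Nat.cast_zero, zero_pow (by omega : k ≠ 0), div_zero, zero_add]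
  refine tsum_congr fun n => ?_
  rw [altCoeff, hw, div_mul_eq_mul_div, ← mul_pow]
  push_cast
  norm_num

lemma exp_pi_I_mul : exp (((Real.pi : ℝ) : ℂ) * I) = -1 := exp_pi_mul_I

lemma exp_neg_pi_I_mul : exp (((-Real.pi : ℝ) : ℂ) * I) = -1 := by
  rw [ofReal_neg, neg_mul, exp_neg, exp_pi_mul_I]; norm_num

lemma axis_mem_logStrip {a : ℝ} (h1 : -Real.pi < a) (h2 : a < Real.pi) :
    (a : ℂ) * I ∈ logStrip := by
  constructor <;> simpa

lemma hasDerivAt_comp_neg {G : ℂ → ℂ} {g w : ℂ} (h : HasDerivAt G g (-w)) :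
    HasDerivAt (fun z => G (-z)) (-g) w :=
  (h.comp w (hasDerivAt_neg w)).congr_deriv (by ring)

/-! ### Inversion of the dilogarithm -/

/-- Analytic continuation of the dilogarithm `∑ (-1)^n x^n / n^2` with its inversion formula. -/
lemma exists_dilog_continuation : ∃ D : ℂ → ℂ, DifferentiableOn ℂ D logStrip ∧
    (∀ w ∈ halfStrip, D w = expSeries altCoeff 2 w) ∧
    ∀ w ∈ logStrip, D (-w) = -D w - w ^ 2 / 2 - (Real.pi : ℂ) ^ 2 / 6 := by
  have hd0 : DifferentiableOn ℂ (fun w => -exp w / (1 + exp w)) logStrip :=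
    DifferentiableOn.div (by fun_prop) (by fun_prop) fun w hw => one_add_exp_ne_zero hw
  obtain ⟨D1, hD1, hs1⟩ := exists_primitive_expSeries norm_altCoeff_le 0 hd0
    (fun w hw => (expSeries_altCoeff_zero hw.2).symm)
  have h0 : (0 : ℂ) ∈ logStrip := by simp [logStrip, Real.pi_pos]
  have hinv1 : ∀ w ∈ logStrip, D1 (-w) = D1 w + w := by
    have hl : ∀ w ∈ logStrip, HasDerivAt (fun z => D1 (-z)) (-(-exp (-w) / (1 + exp (-w)))) w :=
      fun w hw => hasDerivAt_comp_neg (hD1 (-w) (neg_mem_logStrip hw))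
    have hr : ∀ w ∈ logStrip, HasDerivAt (fun z => D1 z + z) (-exp w / (1 + exp w) + 1) w :=
      fun w hw => (hD1 w hw).add (hasDerivAt_id w)
    refine isOpen_logStrip.eqOn_of_deriv_eq convex_logStrip.isPreconnected
      (fun w hw => (hl w hw).differentiableAt.differentiableWithinAt)
      (fun w hw => (hr w hw).differentiableAt.differentiableWithinAt)
      (fun w hw => ?_) h0 (by simp)
    rw [(hl w hw).deriv, (hr w hw).deriv]
    have h1 := one_add_exp_ne_zero hw
    have h2 := one_add_exp_ne_zero (neg_mem_logStrip hw)
    rw [exp_neg] at h2 ⊢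
    have h3 := exp_ne_zero w
    have h4 : exp w + 1 ≠ 0 := by rwa [add_comm]
    field_simp
    ring
  obtain ⟨D2, hD2, hs2⟩ := exists_primitive_expSeries norm_altCoeff_le 1
    (fun w hw => (hD1 w hw).differentiableAt.differentiableWithinAt) hs1
  have hdiff : DifferentiableOn ℂ D2 logStrip :=
    fun w hw => (hD2 w hw).differentiableAt.differentiableWithinAt
  refine ⟨D2, hdiff, hs2, ?_⟩
  have hl : ∀ w ∈ logStrip,
      HasDerivAt (fun z => D2 (-z) + D2 z + z ^ 2 / 2) 0 w := by
    intro w hw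
    refine (((hasDerivAt_comp_neg (hD2 (-w) (neg_mem_logStrip hw))).add (hD2 w hw)).add
      ((hasDerivAt_pow 2 w).div_const 2)).congr_deriv ?_
    rw [hinv1 w hw]; push_cast; ring
  obtain ⟨c, hc⟩ := isOpen_logStrip.exists_is_const_of_deriv_eq_zero
    convex_logStrip.isPreconnected
    (fun w hw => (hl w hw).differentiableAt.differentiableWithinAt) (fun w hw => (hl w hw).deriv)
  have haxis : ∀ w ∈ logStrip, w.re ≤ 0 → D2 w = expSeries altCoeff 2 w := fun w hw hre =>
    eq_on_axis (hdiff.continuousOn.mono fun z hz => hz.1)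
      ((continuousOn_expSeries norm_altCoeff_le le_rfl).mono fun z hz => hz.2) hs2 hw hre
  have hA := continuous_expSeries_axis norm_altCoeff_le le_rfl
  -- The constant is read off at `iπ`, outside the strip but still in reach of the series: `c =
  -- 2ζ(2) - π²/2 = -π²/6`.
  have hseg := (eq_on_closed_segment
    (p := fun a : ℝ => expSeries altCoeff 2 (((-a : ℝ) : ℂ) * I) + expSeries altCoeff 2 (a * I)
      + ((a : ℂ) * I) ^ 2 / 2) (q := fun _ => c)
    (((hA.comp continuous_neg).add hA).add (by fun_prop)) continuous_const (by
      intro a h1 h2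
      have hm := axis_mem_logStrip h1 h2
      rw [← hc _ hm]
      have e : ((-a : ℝ) : ℂ) * I = -(a * I) := by push_cast; ring
      rw [e, ← haxis _ hm (by simp), ← haxis _ (neg_mem_logStrip hm) (by simp)])).1
  rw [expSeries_altCoeff_pi le_rfl exp_neg_pi_I_mul, expSeries_altCoeff_pi le_rfl exp_pi_I_mul,
    Nat.cast_ofNat, riemannZeta_two, mul_pow, I_sq] at hseg
  intro w hw
  have := hc w hw
  linear_combination this - hseg

/-! ### Expansion at infinity with undetermined constants -/

/-- The part of the expansion of the inverted series that involves no integration constants;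
`A j` stands for `∑ (-1)^n x^n / n^j` and `B` for `∑ (-1)^n H_{n,2} x^n / n^k`. -/
noncomputable def expansionCore (k : ℕ) (A : ℕ → ℂ) (B w : ℂ) : ℂ :=
  (-1) ^ k * (-((Real.pi : ℂ) ^ 2 / 6) * A k
    - (w ^ 2 / 2 * A k - k * w * A (k + 1) + k * (k + 1) / 2 * A (k + 2) + B))

/-- The polynomial part `∑_{j ≤ m} e_{m-j} (-w)^j / j!` of the expansion. -/
noncomputable def expansionPoly (e : ℕ → ℂ) (m : ℕ) (w : ℂ) : ℂ :=
  ∑ j ∈ Finset.range (m + 1), e (m - j) * (-w) ^ j / (Nat.factorial j : ℂ)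

/-- The expansion of the continued series at infinity, in the coordinate `w`. -/
noncomputable def expansion (k : ℕ) (e : ℕ → ℂ) (w : ℂ) : ℂ :=
  expansionCore k (fun j => expSeries altCoeff j w) (expSeries altHarmonicCoeff k w) w
    + expansionPoly e (k + 2) w

/-- `f` continues the series `Π_{k,2}` to the whole strip. -/
def IsStripContinuation (k : ℕ) (f : ℂ → ℂ) : Prop :=
  DifferentiableOn ℂ f logStrip ∧ ∀ w ∈ halfStrip, f w = expSeries piCoeff k w

/-- The constants `e` describe the expansion of the continuation of `Π_{k,2}` at infinity. -/
def HasExpansion (k : ℕ) (e : ℕ → ℂ) : Prop :=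
  ∃ f, IsStripContinuation k f ∧ ∀ w ∈ halfStrip, f (-w) = expansion k e w

lemma expansionPoly_succ (e : ℕ → ℂ) (m : ℕ) (w : ℂ) :
    expansionPoly e (m + 1) w = e (m + 1)
      + ∑ j ∈ Finset.range (m + 1), e (m - j) * (-w) ^ (j + 1) / (Nat.factorial (j + 1) : ℂ) := by
  rw [expansionPoly, Finset.sum_range_succ', add_comm]
  simp

lemma hasDerivAt_expansionPoly (e : ℕ → ℂ) (m : ℕ) (w : ℂ) :
    HasDerivAt (expansionPoly e (m + 1)) (-expansionPoly e m w) w := by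
  have : HasDerivAt (fun w => e (m + 1)
      + ∑ j ∈ Finset.range (m + 1), e (m - j) * (-w) ^ (j + 1) / (Nat.factorial (j + 1) : ℂ))
      (∑ j ∈ Finset.range (m + 1), -(e (m - j) * (-w) ^ j / (Nat.factorial j : ℂ))) w := by
    refine HasDerivAt.const_add _ (HasDerivAt.fun_sum fun j _ => ?_)
    refine ((((hasDerivAt_neg w).pow (j + 1)).const_mul (e (m - j))).div_const _).congr_deriv ?_
    have hj : (Nat.factorial j : ℂ) ≠ 0 := Nat.cast_ne_zero.2 (Nat.factorial_ne_zero j)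
    have hj' : (j : ℂ) + 1 ≠ 0 := Nat.cast_add_one_ne_zero j
    rw [Nat.factorial_succ]
    push_cast
    field_simp
  rw [Finset.sum_neg_distrib] at this
  exact this.congr_of_eventuallyEq (Eventually.of_forall fun z => expansionPoly_succ e m z)

/-- The coefficients `w²/2`, `-kw`, `k(k+1)/2` come from repeated integration by parts of `w²/2 * A
0`. The minus sign is that of `w ↦ -w`, absorbed by `(-1)^k`. -/
lemma hasDerivAt_expansion (k : ℕ) (e : ℕ → ℂ) {w : ℂ} (hw : w.re < 0) :
    HasDerivAt (expansion (k + 1) e) (-expansion k e w) w := by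
  have hA : ∀ j, HasDerivAt (expSeries altCoeff (j + 1)) (expSeries altCoeff j w) w := fun j =>
    hasDerivAt_expSeries norm_altCoeff_le j hw
  have hB : HasDerivAt (expSeries altHarmonicCoeff (k + 1)) (expSeries altHarmonicCoeff k w) w :=
    hasDerivAt_expSeries norm_altHarmonicCoeff_le k hw
  have hP := hasDerivAt_expansionPoly e (k + 2) w
  have hsq : HasDerivAt (fun z : ℂ => z ^ 2 / 2) w w :=
    ((hasDerivAt_pow 2 w).div_const 2).congr_deriv (by push_cast; ring)
  have hlin : HasDerivAt (fun z : ℂ => ((k + 1 : ℕ) : ℂ) * z) ((k + 1 : ℕ) : ℂ) w :=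
    ((hasDerivAt_id w).const_mul _).congr_deriv (by ring)
  refine (((((hA k).const_mul (-((Real.pi : ℂ) ^ 2 / 6))).sub
    ((((hsq.mul (hA k)).sub (hlin.mul (hA (k + 1)))).add
      ((hA (k + 2)).const_mul _)).add hB)).const_mul ((-1) ^ (k + 1))).add hP).congr_deriv ?_
  simp only [expansion, expansionCore]
  push_cast
  ring

lemma exists_continuation_succ {k : ℕ} {f : ℂ → ℂ} (hf : IsStripContinuation k f) :
    ∃ g, IsStripContinuation (k + 1) g ∧ ∀ w ∈ logStrip, HasDerivAt g (f w) w := by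
  obtain ⟨g, hg, hgs⟩ := exists_primitive_expSeries norm_piCoeff_le k hf.1 hf.2
  exact ⟨g, ⟨fun w hw => (hg w hw).differentiableAt.differentiableWithinAt, hgs⟩, hg⟩

lemma expansion_update (k : ℕ) (e : ℕ → ℂ) {m : ℕ} (hm : k + 2 < m) (c w : ℂ) :
    expansion k (Function.update e m c) w = expansion k e w := by
  rw [expansion, expansion, expansionPoly, expansionPoly]
  congr 1
  refine Finset.sum_congr rfl fun j _ => ?_
  rw [Function.update_of_ne (by omega)]

lemma expansion_update_self (k : ℕ) (e : ℕ → ℂ) (c w : ℂ) :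
    expansion (k + 1) (Function.update e (k + 3) c) w
      = expansion (k + 1) e w + (c - e (k + 3)) := by
  have h : ∀ j, Function.update e (k + 3) c (k + 2 - j) = e (k + 2 - j) := fun j =>
    Function.update_of_ne (by omega) _ _
  rw [expansion, expansion, expansionPoly_succ, expansionPoly_succ]
  simp only [h, Function.update_self]
  ring

/-- At `-w` the prefactor is `1 / (1 + exp w) = 1 + A 0`; its summand `1` times `-w²/2 - π²/6` is
the polynomial part. -/
lemma hasExpansion_zero {e : ℕ → ℂ} (h0 : e 0 = -1) (h1 : e 1 = 0)
    (h2 : e 2 = -((Real.pi : ℂ) ^ 2 / 6)) : HasExpansion 0 e := by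
  obtain ⟨D, hD, hs, hinv⟩ := exists_dilog_continuation
  refine ⟨fun w => exp w * D w / (1 + exp w), ⟨?_, ?_⟩, ?_⟩
  · exact DifferentiableOn.div (by fun_prop) (by fun_prop) fun w hw => one_add_exp_ne_zero hw
  · intro w hw
    rw [div_eq_iff (one_add_exp_ne_zero hw.1), hs w hw, mul_comm (expSeries _ _ _),
      expSeries_piCoeff_zero hw.2]
  · intro w hw
    have hn := one_add_exp_ne_zero hw.1
    have hB := one_add_exp_mul_expSeries_altHarmonicCoeff hw.2
    have hB' : expSeries altHarmonicCoeff 0 w = expSeries altCoeff 2 w / (1 + exp w) := by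
      rw [eq_div_iff hn, mul_comm, hB]
    have hn' := one_add_exp_ne_zero (neg_mem_logStrip hw.1)
    simp only [expansion, expansionCore, expansionPoly, Finset.sum_range_succ, Finset.sum_range_zero]
    rw [hB', expSeries_altCoeff_zero hw.2, hinv w hw.1, hs w hw]
    simp only [h0, h1, h2, zero_add, Nat.sub_zero, Nat.sub_self, Nat.reduceSub]
    rw [exp_neg] at hn' ⊢
    have h3 := exp_ne_zero w
    have h4 : exp w + 1 ≠ 0 := by rwa [add_comm]
    simp only [Nat.factorial, pow_zero, pow_one, Nat.cast_zero]
    push_cast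
    field_simp
    ring

lemma exists_expansion_constants (N : ℕ) : ∃ e : ℕ → ℂ, e 0 = -1 ∧ e 1 = 0 ∧
    e 2 = -((Real.pi : ℂ) ^ 2 / 6) ∧ ∀ k ≤ N, HasExpansion k e := by
  induction N with
  | zero =>
    refine ⟨fun n => if n = 0 then -1 else if n = 1 then 0 else -((Real.pi : ℂ) ^ 2 / 6),
      by simp, by simp, by simp, fun k hk => ?_⟩
    obtain rfl : k = 0 := by omega
    exact hasExpansion_zero (by simp) (by simp) (by simp)
  | succ N ih =>
    obtain ⟨e, h0, h1, h2, hk⟩ := ih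
    obtain ⟨f, hf, hfe⟩ := hk N le_rfl
    obtain ⟨g, hg, hgd⟩ := exists_continuation_succ hf
    -- The new constant makes both sides agree at `w = -1`. Lower levels never see the entry `N +
    -- 3`, so one sequence serves all levels.
    set c : ℂ := e (N + 3) + (g (-(-1)) - expansion (N + 1) e (-1)) with hc
    refine ⟨Function.update e (N + 3) c, by rw [Function.update_of_ne (by omega), h0],
      by rw [Function.update_of_ne (by omega), h1], by rw [Function.update_of_ne (by omega), h2],
      fun k hkN => ?_⟩
    rcases Nat.lt_or_ge k (N + 1) with hlt | hge
    · obtain ⟨f', hf', hfe'⟩ := hk k (by omega)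
      exact ⟨f', hf', fun w hw => by rw [expansion_update k e (by omega), hfe' w hw]⟩
    · obtain rfl : k = N + 1 := by omega
      refine ⟨g, hg, ?_⟩
      have hl : ∀ w ∈ halfStrip, HasDerivAt (fun z => g (-z)) (-f (-w)) w := fun w hw =>
        hasDerivAt_comp_neg (hgd (-w) (neg_mem_logStrip hw.1))
      have hr : ∀ w ∈ halfStrip,
          HasDerivAt (expansion (N + 1) (Function.update e (N + 3) c)) (-expansion N e w) w := by
        intro w hw
        have := hasDerivAt_expansion N (Function.update e (N + 3) c) hw.2
        rwa [expansion_update N e (by omega)] at this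
      refine isOpen_halfStrip.eqOn_of_deriv_eq convex_halfStrip.isPreconnected
        (fun w hw => (hl w hw).differentiableAt.differentiableWithinAt)
        (fun w hw => (hr w hw).differentiableAt.differentiableWithinAt)
        (fun w hw => ?_) neg_one_mem_halfStrip ?_
      · rw [(hl w hw).deriv, (hr w hw).deriv, hfe w hw]
      · rw [expansion_update_self, hc]; ring

/-! ### Determination of the constants -/

/-- The expansion takes the same value on both sides of the point `x = -1`. -/
lemma expansion_neg_pi_eq_expansion_pi {k : ℕ} (hk : 2 ≤ k) {e : ℕ → ℂ} (h : HasExpansion k e) :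
    expansion k e (((-Real.pi : ℝ) : ℂ) * I) = expansion k e (((Real.pi : ℝ) : ℂ) * I) := by
  obtain ⟨f, ⟨hfd, hfs⟩, hfe⟩ := h
  have hA : ∀ j, 2 ≤ j → ContinuousOn (expSeries altCoeff j) {w | w.re ≤ 0} := fun j hj =>
    continuousOn_expSeries norm_altCoeff_le hj
  have hcont : ContinuousOn (expansion k e) {w | w.re ≤ 0} := by
    have h0 := hA k hk
    have h1 := hA (k + 1) (by omega)
    have h2 := hA (k + 2) (by omega)
    have h3 := continuousOn_expSeries norm_altHarmonicCoeff_le hk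
    unfold expansion expansionCore expansionPoly
    fun_prop
  have hax : ∀ w ∈ logStrip, w.re ≤ 0 → f w = expSeries piCoeff k w := fun w hw hre =>
    eq_on_axis (hfd.continuousOn.mono fun z hz => hz.1)
      ((continuousOn_expSeries norm_piCoeff_le hk).mono fun z hz => hz.2) hfs hw hre
  have hex : ∀ w ∈ logStrip, w.re ≤ 0 → f (-w) = expansion k e w := fun w hw hre =>
    eq_on_axis (f := fun z => f (-z))
      (hfd.continuousOn.comp continuousOn_neg fun z hz => neg_mem_logStrip hz.1)
      (hcont.mono fun z hz => hz.2) hfe hw hre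
  obtain ⟨h1, h2⟩ := eq_on_closed_segment
    (p := fun a : ℝ => expSeries piCoeff k (((-a : ℝ) : ℂ) * I))
    (q := fun a : ℝ => expansion k e ((a : ℂ) * I))
    ((continuous_expSeries_axis norm_piCoeff_le hk).comp continuous_neg)
    (hcont.comp_continuous (by fun_prop) (by intro a; simp)) (by
      intro a ha1 ha2
      have hm := axis_mem_logStrip ha1 ha2
      have e' : ((-a : ℝ) : ℂ) * I = -(a * I) := by push_cast; ring
      rw [e', ← hax _ (neg_mem_logStrip hm) (by simp), hex _ hm (by simp)])
  -- Both end values are the same series, since it depends on `w` only through `exp w = -1`.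
  simp only [neg_neg] at h1 h2
  rw [← h1, ← h2]
  simp only [expSeries, exp_pi_I_mul, exp_neg_pi_I_mul]

/-- Only the term linear in `w` is odd under `iπ ↦ -iπ`; everything else cancels. -/
lemma expansionCore_pi_sub {k : ℕ} (hk : 2 ≤ k) :
    let core := fun w => expansionCore k (fun j => expSeries altCoeff j w)
      (expSeries altHarmonicCoeff k w) w
    core (((Real.pi : ℝ) : ℂ) * I) - core (((-Real.pi : ℝ) : ℂ) * I)
      = (-1) ^ k * (2 * k * (Real.pi * I) * riemannZeta ((k + 1 : ℕ) : ℂ)) := by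
  have hB : expSeries altHarmonicCoeff k (((-Real.pi : ℝ) : ℂ) * I)
      = expSeries altHarmonicCoeff k (((Real.pi : ℝ) : ℂ) * I) := by
    simp only [expSeries, exp_pi_I_mul, exp_neg_pi_I_mul]
  have h1 := fun j (hj : 2 ≤ j) => expSeries_altCoeff_pi hj exp_pi_I_mul
  have h2 := fun j (hj : 2 ≤ j) => expSeries_altCoeff_pi hj exp_neg_pi_I_mul
  simp only [expansionCore]
  rw [hB, h1 k hk, h2 k hk, h1 (k + 1) (by omega), h2 (k + 1) (by omega), h1 (k + 2) (by omega),
    h2 (k + 2) (by omega)]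
  push_cast
  ring

/-- The recursion for the integration constants. -/
lemma expansion_constant_recursion {k : ℕ} (hk : 2 ≤ k) {e : ℕ → ℂ} (h : HasExpansion k e) :
    e (k + 1) = (-1) ^ k * k * riemannZeta ((k + 1 : ℕ) : ℂ)
      - (∑ j ∈ Finset.range (k + 1), e (k - j) * ((Real.pi * I) ^ (j + 1) + (-(Real.pi * I)) ^ (j + 1))
          / (Nat.factorial (j + 2) : ℂ)) / 2 := by
  have h1 := expansion_neg_pi_eq_expansion_pi hk h
  have h2 := expansionCore_pi_sub hk
  have hpi : (Real.pi : ℂ) * I ≠ 0 :=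
    mul_ne_zero (ofReal_ne_zero.2 Real.pi_ne_zero) I_ne_zero
  simp only [expansion] at h1
  have h3 : expansionPoly e (k + 2) (((-Real.pi : ℝ) : ℂ) * I)
      - expansionPoly e (k + 2) (((Real.pi : ℝ) : ℂ) * I)
      = (Real.pi * I) * ∑ j ∈ Finset.range (k + 2),
        e (k + 1 - j) * ((Real.pi * I) ^ j + (-(Real.pi * I)) ^ j)
          / (Nat.factorial (j + 1) : ℂ) := by
    rw [expansionPoly_succ, expansionPoly_succ, add_sub_add_left_eq_sub, ← Finset.sum_sub_distrib,
      Finset.mul_sum]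
    refine Finset.sum_congr rfl fun j _ => ?_
    push_cast
    rw [neg_mul, neg_neg]
    ring
  have h4 : (Real.pi * I) * ∑ j ∈ Finset.range (k + 2),
        e (k + 1 - j) * ((Real.pi * I) ^ j + (-(Real.pi * I)) ^ j) / (Nat.factorial (j + 1) : ℂ)
      = (Real.pi * I) * ((-1) ^ k * (2 * k * riemannZeta ((k + 1 : ℕ) : ℂ))) := by
    rw [← h3]
    linear_combination h1 + h2
  have h5 := mul_left_cancel₀ hpi h4
  -- The split-off term `j = 0` is `2 * e (k + 1)`, the unknown being solved for.
  rw [Finset.sum_range_succ'] at h5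
  simp only [Nat.add_sub_add_right, Nat.sub_zero, pow_zero, zero_add, Nat.factorial_one,
    Nat.cast_one, div_one, add_assoc, Nat.reduceAdd] at h5 ⊢
  linear_combination h5 / 2

lemma pi_mem_zetaField (K : ℕ) : (Real.pi : ℂ) ∈ zetaField K :=
  IntermediateField.subset_adjoin ℚ _ (Or.inl rfl)

lemma riemannZeta_mem_zetaField {K m : ℕ} (h1 : 3 ≤ m) (h2 : m ≤ K + 2) :
    riemannZeta (m : ℂ) ∈ zetaField K :=
  IntermediateField.subset_adjoin ℚ _ (Or.inr ⟨m, h1, h2, rfl⟩)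

/-- Odd powers cancel and even ones are real, so `I` is never needed in the field. -/
lemma pi_mul_I_pow_add_mem (K j : ℕ) :
    ((Real.pi : ℂ) * I) ^ j + (-(Real.pi * I)) ^ j ∈ zetaField K := by
  rcases Nat.even_or_odd j with ⟨m, rfl⟩ | hj
  · have : ((Real.pi : ℂ) * I) ^ (m + m) + (-(Real.pi * I)) ^ (m + m)
        = 2 * (-((Real.pi : ℂ) ^ 2)) ^ m := by
      have e1 : ((Real.pi : ℂ) * I) ^ 2 = -((Real.pi : ℂ) ^ 2) := by
        rw [mul_pow, I_sq]; ring
      rw [← two_mul, pow_mul, pow_mul, neg_sq, e1]; ring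
    rw [this]
    exact mul_mem (ofNat_mem _ 2) (pow_mem (neg_mem (pow_mem (pi_mem_zetaField K) 2)) m)
  · rw [hj.neg_pow, add_neg_cancel]
    exact zero_mem _

/-- Level `k` fixes `e (k + 1)`, so reaching `e (K + 2)` takes one level beyond `K`. -/
lemma expansion_constant_mem {K : ℕ} {e : ℕ → ℂ} (h0 : e 0 = -1) (h1 : e 1 = 0)
    (h2 : e 2 = -((Real.pi : ℂ) ^ 2 / 6)) (h : ∀ k ≤ K + 1, HasExpansion k e) (m : ℕ)
    (hm : m ≤ K + 2) : e m ∈ zetaField K := by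
  induction m using Nat.strong_induction_on with
  | _ m ih =>
    match m with
    | 0 => rw [h0]; exact neg_mem (one_mem _)
    | 1 => rw [h1]; exact zero_mem _
    | 2 =>
      rw [h2]
      exact neg_mem (div_mem (pow_mem (pi_mem_zetaField K) 2) (ofNat_mem _ 6))
    | k + 3 =>
      rw [expansion_constant_recursion (k := k + 2) (by omega) (h _ (by omega))]
      refine sub_mem (mul_mem (mul_mem (pow_mem (neg_mem (one_mem _)) _) (natCast_mem _ _))
        (riemannZeta_mem_zetaField (by omega) hm)) (div_mem (sum_mem fun j hj => ?_)
        (ofNat_mem _ 2))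
      exact div_mem (mul_mem (ih _ (by omega) (by omega)) (pi_mul_I_pow_add_mem K _))
        (natCast_mem _ _)

/-! ### The canonical basis and the return to the slit plane -/

lemma varpi_exp_of_lt {k i : ℕ} (hi : i < k) {w : ℂ} (hw : w ∈ logStrip) :
    varpi k i (exp w) = w ^ i := by
  rw [varpi, if_pos hi, log_exp hw.1 hw.2.le]

lemma varpi_exp_self (k : ℕ) {w : ℂ} (hw : w ∈ logStrip) :
    varpi k k (exp w) = w ^ k + (Nat.factorial k : ℂ) * expSeries altCoeff k w := by
  rw [varpi, if_neg (lt_irrefl k), if_pos rfl, log_exp hw.1 hw.2.le, altPolylog_exp]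

lemma varpi_exp_succ (k : ℕ) {w : ℂ} (hw : w ∈ logStrip) :
    varpi k (k + 1) (exp w) = w ^ (k + 1) + (Nat.factorial (k + 1) : ℂ) *
      (w * expSeries altCoeff k w - k * expSeries altCoeff (k + 1) w) := by
  rw [varpi, if_neg (by omega), if_neg (by omega), if_pos rfl, log_exp hw.1 hw.2.le,
    altPolylog_exp, altPolylog_exp, Nat.factorial_succ]
  push_cast
  ring

lemma varpi_exp_add_two (k : ℕ) {w : ℂ} (hw : w ∈ halfStrip) :
    varpi k (k + 2) (exp w) = w ^ (k + 2) + (Nat.factorial (k + 2) : ℂ) *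
      (w ^ 2 / 2 * expSeries altCoeff k w - k * w * expSeries altCoeff (k + 1) w
        + k * (k + 1) / 2 * expSeries altCoeff (k + 2) w + expSeries altHarmonicCoeff k w) := by
  rw [varpi, if_neg (by omega), if_neg (by omega), if_neg (by omega), log_exp hw.1.1 hw.1.2.le,
    altPolylog_exp, altPolylog_exp, lastSeries_exp k hw.2, Nat.cast_choose_two,
    Nat.cast_choose_two, Nat.factorial_succ (k + 1), Nat.factorial_succ k]
  push_cast
  ring

/-- The powers of `w` give the polynomial part; the series in the top three basis functions,
weighted by `e 2`, `e 1 = 0` and `e 0`, give exactly `expansionCore`. -/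
lemma sum_varpi_exp {k : ℕ} {e : ℕ → ℂ} (h0 : e 0 = -1) (h1 : e 1 = 0)
    (h2 : e 2 = -((Real.pi : ℂ) ^ 2 / 6)) {w : ℂ} (hw : w ∈ halfStrip) :
    ∑ i : Fin (k + 3), (e (k + 2 - i) * (-1) ^ (i : ℕ) / (Nat.factorial i : ℂ))
      * varpi k i (exp w) = expansion k e w := by
  rw [Fin.sum_univ_eq_sum_range
    (fun i => (e (k + 2 - i) * (-1) ^ i / (Nat.factorial i : ℂ)) * varpi k i (exp w)) (k + 3),
    Finset.sum_range_succ, Finset.sum_range_succ, Finset.sum_range_succ, expansion, expansionPoly,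
    Finset.sum_range_succ, Finset.sum_range_succ, Finset.sum_range_succ,
    varpi_exp_self k hw.1, varpi_exp_succ k hw.1, varpi_exp_add_two k hw]
  have hs : ∑ i ∈ Finset.range k,
      (e (k + 2 - i) * (-1) ^ i / (Nat.factorial i : ℂ)) * varpi k i (exp w)
      = ∑ i ∈ Finset.range k, e (k + 2 - i) * (-w) ^ i / (Nat.factorial i : ℂ) := by
    refine Finset.sum_congr rfl fun i hi => ?_
    rw [varpi_exp_of_lt (Finset.mem_range.1 hi) hw.1, neg_pow w]
    ring
  have e1 : k + 2 - (k + 1) = 1 := by omega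
  have e2 : k + 2 - k = 2 := by omega
  rw [hs, Nat.sub_self, e1, e2, h0, h1, h2, expansionCore, neg_pow w k, neg_pow w (k + 2)]
  have f1 : (Nat.factorial k : ℂ) ≠ 0 := Nat.cast_ne_zero.2 (Nat.factorial_ne_zero _)
  have f2 : (Nat.factorial (k + 2) : ℂ) ≠ 0 := Nat.cast_ne_zero.2 (Nat.factorial_ne_zero _)
  field_simp
  ring

lemma log_mem_logStrip {x : ℂ} (hx : x ∈ slitPlane) : log x ∈ logStrip := by
  refine ⟨neg_pi_lt_log_im x, lt_of_le_of_ne (log_im_le_pi x) ?_⟩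
  rw [log_im]
  exact slitPlane_arg_ne_pi hx

lemma log_mem_halfStrip {x : ℂ} (hx : x ∈ slitPlane) (h : ‖x‖ < 1) : log x ∈ halfStrip := by
  refine ⟨log_mem_logStrip hx, ?_⟩
  rw [log_re]
  exact Real.log_neg (norm_pos_iff.2 (slitPlane_ne_zero hx)) h

lemma IsStripContinuation.isPiContinuation {k : ℕ} {f : ℂ → ℂ} (hf : IsStripContinuation k f) :
    IsPiContinuation k fun x => f (log x) := by
  refine ⟨?_, fun x hx h => ?_⟩
  · exact hf.1.comp (fun x hx => (differentiableAt_log hx).differentiableWithinAt)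
      fun x hx => log_mem_logStrip hx
  · simp only []
    rw [hf.2 _ (log_mem_halfStrip hx h), ← PiSeries_exp, exp_log (slitPlane_ne_zero hx)]

lemma HasExpansion.isExpansionCoeff {k : ℕ} {e : ℕ → ℂ} (h0 : e 0 = -1) (h1 : e 1 = 0)
    (h2 : e 2 = -((Real.pi : ℂ) ^ 2 / 6)) (h : HasExpansion k e) :
    IsExpansionCoeff k fun i : Fin (k + 3) =>
      e (k + 2 - i) * (-1) ^ (i : ℕ) / (Nat.factorial i : ℂ) := by
  obtain ⟨f, hf, hfe⟩ := h
  refine ⟨_, hf.isPiContinuation, fun y hy hy1 => ?_⟩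
  have hw := log_mem_halfStrip hy hy1
  have hs := sum_varpi_exp (k := k) h0 h1 h2 hw
  rw [exp_log (slitPlane_ne_zero hy)] at hs
  rw [hs, ← hfe _ hw, one_div, log_inv _ (slitPlane_arg_ne_pi hy)]

lemma IsPiContinuation.eqOn {k : ℕ} {F G : ℂ → ℂ} (hF : IsPiContinuation k F)
    (hG : IsPiContinuation k G) : Set.EqOn F G slitPlane := by
  have hmem : ((1 / 2 : ℝ) : ℂ) ∈ slitPlane := ofReal_mem_slitPlane.2 (by norm_num)
  refine (hF.1.analyticOnNhd isOpen_slitPlane).eqOn_of_preconnected_of_eventuallyEq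
    (hG.1.analyticOnNhd isOpen_slitPlane)
    (starConvex_one_slitPlane.isPathConnected one_mem_slitPlane).isConnected.isPreconnected
    hmem ?_
  have hb : ∀ᶠ x : ℂ in 𝓝 ((1 / 2 : ℝ) : ℂ), ‖x‖ < 1 := by
    refine (isOpen_lt continuous_norm continuous_const).mem_nhds ?_
    change ‖((1 / 2 : ℝ) : ℂ)‖ < 1
    rw [norm_real]; norm_num
  filter_upwards [hb, isOpen_slitPlane.mem_nhds hmem] with x h1 h2
  rw [hF.2 x h2 h1, hG.2 x h2 h1]

/-! ### Uniqueness of the coefficients -/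

lemma norm_expSeries_le {b : ℕ → ℂ} {C : ℝ} (hb : ∀ n, ‖b n‖ ≤ C) (k : ℕ) {w : ℂ}
    (hw : w.re < 0) : ‖expSeries b k w‖ ≤ C * Real.exp w.re / (1 - Real.exp w.re) := by
  have h := (hasSum_geometric_of_lt_one (norm_nonneg (exp w)) (norm_exp_lt_one hw)).mul_left
    (C * ‖exp w‖)
  rw [← norm_exp, div_eq_mul_inv]
  refine tsum_of_norm_bounded h fun n => (norm_expSeries_term_le hb k w n).trans_eq ?_
  rw [pow_succ']; ring

lemma tendsto_pow_mul_expSeries {b : ℕ → ℂ} {C : ℝ} (hb : ∀ n, ‖b n‖ ≤ C) (k m : ℕ) :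
    Tendsto (fun t : ℝ => (-(t : ℂ)) ^ m * expSeries b k (-(t : ℂ))) atTop (𝓝 0) := by
  have h1 := Real.tendsto_pow_mul_exp_neg_atTop_nhds_zero m
  have h2 : Tendsto (fun t : ℝ => C / (1 - Real.exp (-t))) atTop (𝓝 (C / (1 - 0))) :=
    tendsto_const_nhds.div (tendsto_const_nhds.sub
      (Real.tendsto_exp_atBot.comp tendsto_neg_atTop_atBot)) (by norm_num)
  refine squeeze_zero_norm' ?_ (by simpa using h1.mul h2)
  filter_upwards [eventually_gt_atTop 0] with t ht
  have := norm_expSeries_le hb k (w := -(t : ℂ)) (by simpa using ht)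
  rw [norm_mul, norm_pow, norm_neg, norm_real, Real.norm_of_nonneg ht.le]
  calc _ ≤ t ^ m * (C * Real.exp (-(t : ℂ)).re / (1 - Real.exp (-(t : ℂ)).re)) := by gcongr
    _ = _ := by simp only [neg_re, ofReal_re]; ring

lemma tendsto_varpi_sub_pow (k : ℕ) {i : ℕ} (hi : i < k + 3) :
    Tendsto (fun t : ℝ => varpi k i (exp (-(t : ℂ))) - (-(t : ℂ)) ^ i) atTop (𝓝 0) := by
  have hA := fun j m => tendsto_pow_mul_expSeries norm_altCoeff_le j m
  have hB := tendsto_pow_mul_expSeries norm_altHarmonicCoeff_le k 0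
  have hmem : ∀ t : ℝ, 0 < t → -(t : ℂ) ∈ halfStrip := fun t ht => by
    simp [halfStrip, Real.pi_pos, ht]
  rcases (by omega : i < k ∨ i = k ∨ i = k + 1 ∨ i = k + 2) with h | rfl | rfl | rfl
  · refine tendsto_const_nhds.congr' ?_
    filter_upwards [eventually_gt_atTop 0] with t ht
    rw [varpi_exp_of_lt h (hmem t ht).1, sub_self]
  · have := (hA i 0).const_mul (Nat.factorial i : ℂ)
    rw [mul_zero] at this
    refine this.congr' ?_
    filter_upwards [eventually_gt_atTop 0] with t ht
    rw [varpi_exp_self i (hmem t ht).1]; ring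
  · have := ((hA k 1).sub ((hA (k + 1) 0).const_mul (k : ℂ))).const_mul
      (Nat.factorial (k + 1) : ℂ)
    rw [mul_zero, sub_zero, mul_zero] at this
    refine this.congr' ?_
    filter_upwards [eventually_gt_atTop 0] with t ht
    rw [varpi_exp_succ k (hmem t ht).1]; ring
  · have := (((((hA k 2).const_mul (1 / 2 : ℂ)).sub ((hA (k + 1) 1).const_mul (k : ℂ))).add
      ((hA (k + 2) 0).const_mul ((k : ℂ) * (k + 1) / 2))).add hB).const_mul
      (Nat.factorial (k + 2) : ℂ)
    simp only [mul_zero, sub_zero, add_zero] at this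
    refine this.congr' ?_
    filter_upwards [eventually_gt_atTop 0] with t ht
    rw [varpi_exp_add_two k (hmem t ht)]; ring

lemma varpi_linearIndependent {k : ℕ} {d : Fin (k + 3) → ℂ}
    (h : ∀ y ∈ slitPlane, ‖y‖ < 1 → ∑ i, d i * varpi k i y = 0) : d = 0 := by
  set p : Polynomial ℂ := ∑ i : Fin (k + 3), Polynomial.C (d i) * Polynomial.X ^ (i : ℕ) with hp
  have heval : ∀ z, p.eval z = ∑ i : Fin (k + 3), d i * z ^ (i : ℕ) := fun z => by
    simp [hp, Polynomial.eval_finsetSum]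
  -- By the assumed relation, `p` equals minus the combination of the decaying remainders.
  have hlim : Tendsto (fun t : ℝ => p.eval (-(t : ℂ))) atTop (𝓝 0) := by
    have h1 : Tendsto (fun t : ℝ => -∑ i : Fin (k + 3),
        d i * (varpi k i (exp (-(t : ℂ))) - (-(t : ℂ)) ^ (i : ℕ))) atTop (𝓝 0) := by
      have := (tendsto_finsetSum Finset.univ fun (i : Fin (k + 3)) _ =>
        (tendsto_varpi_sub_pow k i.2).const_mul (d i)).neg
      simpa using this
    refine h1.congr' ?_
    filter_upwards [eventually_gt_atTop 0] with t ht
    have hy : exp (-(t : ℂ)) ∈ slitPlane := by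
      rw [← ofReal_neg, ← ofReal_exp]
      exact ofReal_mem_slitPlane.2 (Real.exp_pos _)
    have h2 := h _ hy (norm_exp_lt_one (by simpa using ht))
    rw [heval]
    simp only [mul_sub, Finset.sum_sub_distrib, h2]
    ring
  have hdeg : p.degree ≤ 0 := by
    by_contra hcon
    have hz : Tendsto (fun t : ℝ => ‖-(t : ℂ)‖) atTop atTop := by
      simpa using tendsto_abs_atTop_atTop
    exact not_tendsto_nhds_of_tendsto_atTop (p.tendsto_norm_atTop (not_le.1 hcon) hz) _ hlim.norm
  have hp0 : p = 0 := by
    rw [Polynomial.eq_C_of_degree_le_zero hdeg] at hlim ⊢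
    simp only [Polynomial.eval_C] at hlim
    rw [tendsto_nhds_unique tendsto_const_nhds hlim, Polynomial.C_0]
  funext i
  have hc : p.coeff i = d i := by
    simp [hp, Polynomial.coeff_X_pow, Fin.val_inj]
  rw [← hc, hp0]
  simp

lemma IsExpansionCoeff.unique {k : ℕ} {τ σ : Fin (k + 3) → ℂ} (hτ : IsExpansionCoeff k τ)
    (hσ : IsExpansionCoeff k σ) : τ = σ := by
  obtain ⟨F, hF, hFe⟩ := hτ
  obtain ⟨G, hG, hGe⟩ := hσ
  refine sub_eq_zero.1 (varpi_linearIndependent (k := k) fun y hy hy1 => ?_)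
  have hmem : 1 / y ∈ slitPlane := by
    have := neg_mem_logStrip (log_mem_logStrip hy)
    rw [mem_slitPlane_iff_arg, one_div, ← log_im, log_inv _ (slitPlane_arg_ne_pi hy)]
    exact ⟨this.2.ne, inv_ne_zero (slitPlane_ne_zero hy)⟩
  have := hF.eqOn hG hmem
  rw [hFe y hy hy1, hGe y hy hy1] at this
  simp only [Pi.sub_apply, sub_mul, Finset.sum_sub_distrib, this, sub_self]

theorem mainTheorem12 (k : ℕ) (hk : 2 ≤ k) :
    (∃! τ : Fin (k + 3) → ℂ, IsExpansionCoeff k τ) ∧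
      ∀ τ : Fin (k + 3) → ℂ, IsExpansionCoeff k τ → ∀ i, τ i ∈ zetaField k := by
  obtain ⟨e, h0, h1, h2, he⟩ := exists_expansion_constants (k + 1)
  have hτ := (he k (by omega)).isExpansionCoeff h0 h1 h2
  refine ⟨⟨_, hτ, fun σ hσ => hσ.unique hτ⟩, fun σ hσ i => ?_⟩
  rw [hσ.unique hτ]
  exact div_mem (mul_mem (expansion_constant_mem h0 h1 h2 he _ (by omega))
    (pow_mem (neg_mem (one_mem _)) _)) (natCast_mem _ _)
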